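/- A \emph{wire} is a set $W$ with two operations $\star,\circ$ such that $(W,\star)$ is a group, $(W,\circ)$ is a semigroup, and $a\circ(b\star c)=(a\circ b)\star a^{-1}\star(a\circ c)$, $(b\star c)\circ a=(b\circ a)\star a^{-1}\star(c\circ a)$ for all $a,b,c\in W$ (inverses are taken with respect to $\star$). It is \emph{commutative} if $\circ$ is commutative. An \emph{isomorphism} of wires is a bijection that preserves both operations. Let $X$ be a set, let $(Y,\circ)$ be the free commutative semigroup on $X$ (nonempty commutative monomials in $X$), and let $(F,\star)$ be the free group on the set $Y$. For $u\in F$ and $m\in Y$ put $u\circ m=\rho_m(u)\star m$, where $\rho_m$ is the endomorphism of $F$ with $\rho_m(y)=(y\circ m)\star m^{-1}$ for $y\in Y$. For $u,v\in F$ put $u\circ_l v=u\star\lambda_u(v)$, where $\lambda_u$ is the endomorphism of $F$ with $\lambda_u(y)=u^{-1}\star(u\circ y)$ for $y\in Y$. Let $N$ be the normal subgroup of $F$ generated by the elements $m^{-1}\star (m\circ l)\star l^{-1}$ with $m,l\in Y$, and $N'=[N,N]$. With $[u]\circ[v]=[u\circ_l v]$, the quotient $F/N'$ is a commutative wire. For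 $s\in Y$ and $u=u_1^{\epsilon_1}\star\cdots\star u_n^{\epsilon_n}\in F$ with $u_i\in Y$ and $\epsilon_i=\pm1$, let $\frac{\partial u}{\partial s}\in\mathbb Z[F/N]$ be the image of the Fox derivative $\sum_{k:\,u_k=s}\epsilon_k u_{(k)}\in\mathbb Z[F]$, where $u_{(k)}=\prod_{i<k}u_i^{\epsilon_i}$ if $\epsilon_k=1$ and $u_{(k)}=\prod_{i\le k}u_i^{\epsilon_i}$ if $\epsilon_k=-1$. Put \[f_u=\Bigl(1-\sum_{s\in Y}\frac{\partial u}{\partial s}\Bigr)+\sum_{s\in Y}\frac{\partial u}{\partial s}\,t_s\in\mathbb Z[F/N][(t_x)_{x\in X}],\] where $t_s=t_{x_1}\cdots t_{x_i}$ if $s=x_1\circ\cdots\circ x_i$. Let $\mathrm{eval}_1,\mathrm{eval}_X:\mathbb Z[F/N][(t_x)_{x\in X}]\to\mathbb Z[F/N]$ be the $\mathbb Z[F/N]$-algebra morphisms with $t_x\mapsto 1$ and $t_x\mapsto[x]$ respectively, and let $\mathcal W(X)$ be the set of polynomials $f$ with $\mathrm{eval}_1(f)=1$ and $\mathrm{eval}_X(f)\in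 F/N$. With $f\star g=f+\mathrm{eval}_X(f)(g-1)$ and $f\circ g=fg$, it is a commutative wire. \textbf{Theorem.} The group $F/N$ is the free commutative group $\mathbb Z^{(X)}$ on the classes $[x]$, $x\in X$. The rule $[u]\mapsto f_u$ gives a well-defined map $\mathfrak d: F/N'\to\mathcal W(X)$, and $\mathfrak d$ is an isomorphism of wires. -/

import Mathlib

/-! ## Wires -/

/-- A wire `(W, ⋆, ∘)`. The group operation `⋆` is written multiplicatively (`*`), the
semigroup operation `∘` is written `⊚`. -/
class Wire (W : Type*) extends Group W where
  circ : W → W → W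
  circ_assoc : ∀ a b c : W, circ (circ a b) c = circ a (circ b c)
  circ_mul : ∀ a b c : W, circ a (b * c) = circ a b * a⁻¹ * circ a c
  mul_circ : ∀ a b c : W, circ (b * c) a = circ b a * a⁻¹ * circ c a

infixl:75 " ⊚ " => Wire.circ

/-- A commutative wire: `∘` is commutative (`⋆` need not be). -/
class CommWire (W : Type*) extends Wire W where
  circ_comm : ∀ a b : W, circ a b = circ b a

structure IsWireHom {W V : Type*} [Wire W] [Wire V] (f : W → V) : Prop where
  map_star : ∀ u v : W, f (u * v) = f u * f v
  map_circ : ∀ u v : W, f (u ⊚ v) = f u ⊚ f v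

structure IsWireIso {W V : Type*} [Wire W] [Wire V] (f : W → V) : Prop
    extends IsWireHom f where
  bijective : Function.Bijective f

/-! ## Fox calculus in a free group -/

namespace Fox

variable {Y : Type*}

/-- The initial section attached to position `k` of a word `u₁^ε₁ ⋯ uₙ^εₙ`: the product of the
letters strictly before position `k` if `ε_k = 1`, and of those up to and including position `k`
if `ε_k = -1`. Positions are numbered from `0`; the Boolean `true` stands for the exponent `1`. -/
def initialSection (L : List (Y × Bool)) (k : Fin L.length) : FreeGroup Y :=
  if (L.get k).2 then FreeGroup.mk (L.take k) else FreeGroup.mk (L.take (k + 1))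

open Classical in
/-- The Fox derivative of a (not necessarily reduced) word: `∑ ε_k u_(k)` over all positions `k`
whose letter is `s^{±1}`. -/
noncomputable def wordDeriv (s : Y) (L : List (Y × Bool)) : MonoidAlgebra ℤ (FreeGroup Y) :=
  ∑ k : Fin L.length,
    if (L.get k).1 = s then
      (if (L.get k).2 then (1 : ℤ) else -1) • MonoidAlgebra.of ℤ (FreeGroup Y) (initialSection L k)
    else 0

open Classical in
theorem wordDeriv_cons (s : Y) (a : Y × Bool) (L : List (Y × Bool)) :
    wordDeriv s (a :: L) =
      (if a.1 = s then
        (if a.2 then 1 else -MonoidAlgebra.of ℤ (FreeGroup Y) (FreeGroup.mk [a])) else 0) +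
      MonoidAlgebra.of ℤ (FreeGroup Y) (FreeGroup.mk [a]) * wordDeriv s L := by
  unfold wordDeriv
  rw [Finset.mul_sum]
  refine (Fin.sum_univ_succ (n := L.length) _).trans ?_
  congr 1
  · rcases a with ⟨y, b⟩
    cases b <;> simp [initialSection, ← FreeGroup.one_eq_mk] <;> rfl
  · refine Finset.sum_congr rfl fun k _ => ?_
    have h : initialSection (a :: L) k.succ = FreeGroup.mk [a] * initialSection L k := by
      simp [initialSection]
    by_cases h1 : (L.get k).1 = s
    · have h1' : ((a :: L).get k.succ).1 = s := h1
      rw [if_pos h1, if_pos h1', h, map_mul, mul_smul_comm]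
      rfl
    · have h1' : ¬ ((a :: L).get k.succ).1 = s := h1
      rw [if_neg h1, if_neg h1', mul_zero]

theorem wordDeriv_append (s : Y) (L M : List (Y × Bool)) :
    wordDeriv s (L ++ M) =
      wordDeriv s L + MonoidAlgebra.of ℤ (FreeGroup Y) (FreeGroup.mk L) * wordDeriv s M := by
  induction L with
  | nil =>
    have h : wordDeriv s ([] : List (Y × Bool)) = 0 := rfl
    rw [List.nil_append, h, ← FreeGroup.one_eq_mk, map_one, one_mul, zero_add]
  | cons a L ih =>
    have h : FreeGroup.mk (a :: L) = FreeGroup.mk [a] * FreeGroup.mk L := by simp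
    rw [List.cons_append, wordDeriv_cons, ih, wordDeriv_cons, h, map_mul]
    noncomm_ring

theorem wordDeriv_step (s : Y) (L M : List (Y × Bool)) (h : FreeGroup.Red.Step L M) :
    wordDeriv s L = wordDeriv s M := by
  obtain ⟨⟩ := h
  rename_i L₁ L₂ x b
  rw [wordDeriv_append, wordDeriv_append, wordDeriv_cons, wordDeriv_cons]
  congr 2
  have h1 : FreeGroup.mk [(x, b)] * FreeGroup.mk [(x, !b)] = 1 := by
    rw [FreeGroup.mul_mk, FreeGroup.one_eq_mk]
    exact Quot.sound (FreeGroup.Red.Step.not (L₁ := []) (L₂ := []))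
  have h2 : MonoidAlgebra.of ℤ (FreeGroup Y) (FreeGroup.mk [(x, b)]) *
      MonoidAlgebra.of ℤ (FreeGroup Y) (FreeGroup.mk [(x, !b)]) = 1 := by
    rw [← map_mul, h1, map_one]
  rw [mul_add, ← mul_assoc, h2, one_mul, ← add_assoc]
  cases b <;> by_cases hx : x = s <;> simp only [hx, if_true, if_false] <;> simp_all

/-- The Fox derivative `∂u/∂s` of an element of the free group, computed from any word that
represents it. -/
noncomputable def deriv (s : Y) : FreeGroup Y → MonoidAlgebra ℤ (FreeGroup Y) :=
  Quot.lift (wordDeriv s) (wordDeriv_step s)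

/-- Only finitely many Fox derivatives of a given element are nonzero. -/
theorem finite_deriv_ne_zero (u : FreeGroup Y) : {s : Y | deriv s u ≠ 0}.Finite := by
  classical
  induction u using Quot.inductionOn with
  | _ L =>
    refine (L.map Prod.fst).toFinset.finite_toSet.subset fun s hs => ?_
    by_contra hn
    refine hs ?_
    change wordDeriv s L = 0
    refine Finset.sum_eq_zero fun k _ => if_neg fun hk => hn ?_
    simp only [List.coe_toFinset, List.mem_map, Set.mem_ofPred_eq]
    exact ⟨L.get k, List.get_mem _ _, hk⟩

end Fox

/-! ## The free commutative wire `F/N'` -/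

namespace FreeCommWire

/-- The free commutative semigroup on `X`: nonzero finitely supported exponent vectors, the
vector `s` standing for the product of the `x ^ s x`. -/
def Mono (X : Type*) : Type _ := {s : X →₀ ℕ // s ≠ 0}

variable {X : Type*}

noncomputable instance : CommSemigroup (Mono X) where
  mul s t := ⟨s.1 + t.1, fun h => s.2 (add_eq_zero.mp h).1⟩
  mul_assoc s t r := Subtype.ext (add_assoc s.1 t.1 r.1)
  mul_comm s t := Subtype.ext (add_comm s.1 t.1)

/-- The generator `x` as a monomial. -/
noncomputable def Mono.var (x : X) : Mono X := ⟨Finsupp.single x 1, by simp⟩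

/-- `F`, the free group on the set of monomials. Its operation is `⋆`. -/
abbrev F (X : Type*) := FreeGroup (Mono X)

/-- A monomial as a generator of `F`. -/
abbrev gen (m : Mono X) : F X := FreeGroup.of m

/-- `ρ_l` for a monomial `l`: the endomorphism of `F` with `m ↦ (m ∘ l) ⋆ l⁻¹`. -/
noncomputable def rhoMono (l : Mono X) : F X →* F X := FreeGroup.lift fun m => gen (m * l) * (gen l)⁻¹

/-- `λ_l` for a monomial `l`: the endomorphism of `F` with `m ↦ l⁻¹ ⋆ (l ∘ m)`. -/
noncomputable def lamMono (l : Mono X) : F X →* F X := FreeGroup.lift fun m => (gen l)⁻¹ * gen (l * m)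

/-- `λ_u` for a word `u`: the endomorphism of `F` with `m ↦ u⁻¹ ⋆ (u ∘ m)`, where
`u ∘ m = ρ_m(u) ⋆ m`. -/
noncomputable def lam (u : F X) : F X →* F X := FreeGroup.lift fun m => u⁻¹ * (rhoMono m u * gen m)

/-- `ρ_v` for a word `v`: the endomorphism of `F` with `m ↦ (m ∘ v) ⋆ v⁻¹`, where
`m ∘ v = m ⋆ λ_m(v)`. -/
noncomputable def rho (v : F X) : F X →* F X := FreeGroup.lift fun m => (gen m * lamMono m v) * v⁻¹

/-- `u ∘_l v = u ⋆ λ_u(v)`. -/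
noncomputable def circL (u v : F X) : F X := u * lam u v

/-- `u ∘_r v = ρ_v(u) ⋆ v`. -/
noncomputable def circR (u v : F X) : F X := rho v u * v

/-- `N`, the normal subgroup of `F` generated by the elements `m⁻¹ ⋆ (m ∘ l) ⋆ l⁻¹`. -/
def N (X : Type*) : Subgroup (F X) :=
  Subgroup.normalClosure {w | ∃ m l : Mono X, w = (gen m)⁻¹ * gen (m * l) * (gen l)⁻¹}

instance : (N X).Normal := Subgroup.normalClosure_normal

/-- The group `F/N`. -/
abbrev FmodN (X : Type*) := F X ⧸ N X

/-- The group `F/N'` with `N' = [N, N]`. -/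
abbrev FmodN' (X : Type*) := F X ⧸ ⁅N X, N X⁆

/-- The projection `F → F/N`. -/
abbrev toN : F X →* FmodN X := QuotientGroup.mk' (N X)

/-- The projection `F → F/N'`. -/
abbrev toN' : F X →* FmodN' X := QuotientGroup.mk' ⁅N X, N X⁆

theorem toN_gen_mul (m l : Mono X) : toN (gen (m * l)) = toN (gen m) * toN (gen l) := by
  have h : toN ((gen m)⁻¹ * gen (m * l) * (gen l)⁻¹) = 1 :=
    (QuotientGroup.eq_one_iff _).mpr (Subgroup.subset_normalClosure ⟨m, l, rfl⟩)
  rw [map_mul, map_mul, map_inv, map_inv, mul_inv_eq_one, inv_mul_eq_iff_eq_mul] at h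
  exact h

theorem toN_comm (u v : F X) : toN u * toN v = toN v * toN u := by
  have key : ∀ a b : Mono X, Commute (toN (gen a)) (toN (gen b)) := fun a b => by
    rw [commute_iff_eq, ← toN_gen_mul, mul_comm, toN_gen_mul]
  have key2 : ∀ (a : Mono X) (v : F X), Commute (toN (gen a)) (toN v) := fun a v => by
    induction v using FreeGroup.induction_on with
    | C1 => rw [map_one]; exact Commute.one_right _
    | of b => exact key a b
    | inv_of b h => rw [map_inv]; exact h.inv_right
    | mul x y hx hy => rw [map_mul]; exact hx.mul_right hy
  have key3 : Commute (toN u) (toN v) := by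
    induction u using FreeGroup.induction_on with
    | C1 => rw [map_one]; exact Commute.one_left _
    | of b => exact key2 b v
    | inv_of b h => rw [map_inv]; exact h.inv_left
    | mul x y hx hy => rw [map_mul]; exact hx.mul_left hy
  exact key3

instance : CommGroup (FmodN X) where
  mul_comm a b := by
    induction a using QuotientGroup.induction_on
    induction b using QuotientGroup.induction_on
    exact toN_comm _ _

theorem toN_rhoMono (l : Mono X) (u : F X) : toN (rhoMono l u) = toN u := by
  have h : toN.comp (rhoMono l) = toN := by
    ext m
    simp only [MonoidHom.comp_apply, rhoMono, FreeGroup.lift_apply_of, map_mul, map_inv,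
      toN_gen_mul, mul_inv_cancel_right]
  exact DFunLike.congr_fun h u

theorem toN_lamMono (l : Mono X) (u : F X) : toN (lamMono l u) = toN u := by
  have h : toN.comp (lamMono l) = toN := by
    ext m
    simp only [MonoidHom.comp_apply, lamMono, FreeGroup.lift_apply_of, map_mul, map_inv,
      toN_gen_mul, inv_mul_cancel_left]
  exact DFunLike.congr_fun h u

theorem toN_lam (v u : F X) : toN (lam v u) = toN u := by
  have h : toN.comp (lam v) = toN := by
    ext m
    simp only [MonoidHom.comp_apply, lam, FreeGroup.lift_apply_of, map_mul, map_inv,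
      toN_rhoMono, inv_mul_cancel_left]
  exact DFunLike.congr_fun h u

theorem toN_rho (v u : F X) : toN (rho v u) = toN u := by
  have h : toN.comp (rho v) = toN := by
    ext m
    simp only [MonoidHom.comp_apply, rho, FreeGroup.lift_apply_of, map_mul, map_inv,
      toN_lamMono, mul_inv_cancel_right]
  exact DFunLike.congr_fun h u

theorem toN'_congr {φ : F X →* F X} (hφ : ∀ u, toN (φ u) = toN u) {u v : F X}
    (h : toN' u = toN' v) : toN' (φ u) = toN' (φ v) := by
  have h1 : N X ≤ (N X).comap φ := fun n hn =>
    (QuotientGroup.eq_one_iff (φ n)).mp ((hφ n).trans ((QuotientGroup.eq_one_iff _).mpr hn))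
  have h2 : ⁅N X, N X⁆ ≤ ⁅N X, N X⁆.comap φ := by
    rw [← Subgroup.map_le_iff_le_comap, Subgroup.map_commutator]
    exact Subgroup.commutator_mono (Subgroup.map_le_iff_le_comap.mpr h1)
      (Subgroup.map_le_iff_le_comap.mpr h1)
  have h3 : u⁻¹ * v ∈ ⁅N X, N X⁆ := QuotientGroup.eq.mp h
  have h4 := h2 h3
  rw [Subgroup.mem_comap, map_mul, map_inv] at h4
  exact QuotientGroup.eq.mpr h4

/-- `F/N` acts by conjugation on `N/N'`. -/
theorem toN'_conj {a b n : F X} (hab : toN a = toN b) (hn : toN n = 1) :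
    toN' (a * n * a⁻¹) = toN' (b * n * b⁻¹) := by
  have h1 : a⁻¹ * b ∈ N X := QuotientGroup.eq.mp hab
  have h2 : n ∈ N X := (QuotientGroup.eq_one_iff n).mp hn
  have h3 := Subgroup.commutator_mem_commutator ((N X).inv_mem h2) h1
  have h4 := (inferInstance : (⁅N X, N X⁆ : Subgroup (F X)).Normal).conj_mem _ h3 a
  refine QuotientGroup.eq.mpr ?_
  convert h4 using 1
  rw [commutatorElement_def]
  group

theorem circR_eq_circL (u v : F X) : circR u v = circL v u := by
  have h1 : ∀ m : Mono X, gen m * lamMono m v = rhoMono m v * gen m := fun m => by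
    have h : (MulAut.conj (gen m)).toMonoidHom.comp (lamMono m) = rhoMono m := by
      ext l
      simp [lamMono, rhoMono, mul_comm]
    rw [← h]
    simp
  have h2 : rho v = (MulAut.conj v).toMonoidHom.comp (lam v) := by
    ext m
    simp [rho, lam, h1]
  rw [circR, circL, h2]
  simp

theorem rho_mul (v w u : F X) :
    toN' (rho (v * w) u) = toN' (rho v u * (v * (u⁻¹ * rho w u) * v⁻¹)) := by
  have hN : ∀ u, toN (u⁻¹ * rho w u) = 1 := fun u => by
    rw [map_mul, map_inv, toN_rho, inv_mul_cancel]
  let φ : F X →* FmodN' X := MonoidHom.mk'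
    (fun u => toN' (rho v u * (v * (u⁻¹ * rho w u) * v⁻¹))) (by
      intro a b
      have hc : toN (rho v b * v * b⁻¹) = toN v := by
        rw [map_mul, map_mul, map_inv, toN_rho, mul_comm (toN b), mul_inv_cancel_right]
      have key := toN'_conj hc (hN a)
      calc toN' (rho v (a * b) * (v * ((a * b)⁻¹ * rho w (a * b)) * v⁻¹))
          = toN' (rho v a) * toN' ((rho v b * v * b⁻¹) * (a⁻¹ * rho w a) *
              (rho v b * v * b⁻¹)⁻¹) * toN' (rho v b * (v * (b⁻¹ * rho w b) * v⁻¹)) := by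
            rw [← map_mul, ← map_mul, map_mul (rho v), map_mul (rho w)]
            congr 1
            group
        _ = _ := by rw [key]; simp only [← map_mul, mul_assoc])
  have h : toN'.comp (rho (v * w)) = φ := by
    ext m
    simp only [φ, MonoidHom.comp_apply, MonoidHom.mk'_apply]
    congr 1
    simp only [rho, FreeGroup.lift_apply_of, map_mul]
    group
  exact DFunLike.congr_fun h u

theorem toN'_circL_eq_circR (u v : F X) : toN' (circL u v) = toN' (circR u v) := by
  let φ : F X →* FmodN' X := MonoidHom.mk' (fun v => toN' (u⁻¹ * circR u v)) (by
    intro a b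
    have h : toN' (circR u (a * b)) = toN' (circR u a * u⁻¹ * circR u b) := by
      rw [circR, map_mul, rho_mul, ← map_mul]
      congr 1
      simp only [circR]
      group
    rw [map_mul, h, ← map_mul, ← map_mul]
    congr 1
    group)
  have h : toN'.comp (lam u) = φ := by
    ext m
    have h2 : rhoMono m u = rho (gen m) u := by
      have : rhoMono m = rho (gen m) := by
        ext l
        simp [rhoMono, rho, lamMono]
      rw [this]
    simp [φ, lam, circR, h2]
  have h3 : toN' (lam u v) = toN' (u⁻¹ * circR u v) := DFunLike.congr_fun h v
  rw [circL, map_mul, h3, ← map_mul, mul_inv_cancel_left]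

theorem toN'_circL_congr {u u' v v' : F X} (hu : toN' u = toN' u') (hv : toN' v = toN' v') :
    toN' (circL u v) = toN' (circL u' v') := by
  have h : ∀ {u u' : F X}, toN' u = toN' u' → ∀ v, toN' (circL v u) = toN' (circL v u') :=
    fun h v => by rw [circL, circL, map_mul, map_mul, toN'_congr (toN_lam v) h]
  rw [h hv u, toN'_circL_eq_circR, circR_eq_circL, h hu v', ← circR_eq_circL,
    ← toN'_circL_eq_circR]

/-- The operation `[u] ∘ [v] = [u ∘_l v]` on `F/N'`; it is also `[u ∘_r v]`, by
`toN'_circL_eq_circR`. -/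
noncomputable def circ : FmodN' X → FmodN' X → FmodN' X :=
  Quotient.map₂ circL fun _ _ hu _ _ hv => Quotient.exact
    (toN'_circL_congr (Quotient.sound hu) (Quotient.sound hv))

theorem circ_toN' (u v : F X) : circ (toN' u) (toN' v) = toN' (circL u v) := rfl

theorem circ_comm (a b : FmodN' X) : circ a b = circ b a := by
  induction a using QuotientGroup.induction_on with | H u =>
  induction b using QuotientGroup.induction_on with | H v =>
  exact (toN'_circL_eq_circR u v).trans (congrArg toN' (circR_eq_circL u v))

theorem circ_mul (a b c : FmodN' X) : circ a (b * c) = circ a b * a⁻¹ * circ a c := by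
  induction a using QuotientGroup.induction_on with | H u =>
  induction b using QuotientGroup.induction_on with | H v =>
  induction c using QuotientGroup.induction_on with | H w =>
  change toN' (circL u (v * w)) = toN' (circL u v) * (toN' u)⁻¹ * toN' (circL u w)
  rw [← map_inv, ← map_mul, ← map_mul]
  congr 1
  simp only [circL, map_mul]
  group

theorem circ_one (a : FmodN' X) : circ a 1 = a := by
  induction a using QuotientGroup.induction_on with | H u =>
  change toN' (circL u 1) = toN' u
  simp [circL]

theorem circ_heap (a b c d : FmodN' X) :
    circ a (b * c⁻¹ * d) = circ a b * (circ a c)⁻¹ * circ a d := by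
  have h : circ a c⁻¹ = a * (circ a c)⁻¹ * a := by
    have h1 := circ_mul a c c⁻¹
    rw [mul_inv_cancel, circ_one] at h1
    rw [mul_assoc, ← inv_mul_eq_iff_eq_mul] at h1
    rw [mul_assoc, h1, mul_inv_cancel_left]
  rw [circ_mul, circ_mul, h]
  group

theorem affine_ext {g h : FmodN' X → FmodN' X}
    (hg : ∀ a b, g (a * b) = g a * (g 1)⁻¹ * g b) (hh : ∀ a b, h (a * b) = h a * (h 1)⁻¹ * h b)
    (h1 : g 1 = h 1) (h2 : ∀ m : Mono X, g (toN' (gen m)) = h (toN' (gen m)))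
    (a : FmodN' X) : g a = h a := by
  induction a using QuotientGroup.induction_on with | H u =>
  let φ : F X →* FmodN' X := MonoidHom.mk' (fun u => (g 1)⁻¹ * g (toN' u)) (by
    intro a b
    rw [map_mul, hg]
    group)
  let ψ : F X →* FmodN' X := MonoidHom.mk' (fun u => (h 1)⁻¹ * h (toN' u)) (by
    intro a b
    rw [map_mul, hh]
    group)
  have : φ = ψ := by
    ext m
    simp only [φ, ψ, MonoidHom.mk'_apply, h1]
    exact congrArg _ (h2 m)
  have h3 : (g 1)⁻¹ * g (toN' u) = (h 1)⁻¹ * h (toN' u) := DFunLike.congr_fun this u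
  rw [h1] at h3
  exact mul_left_cancel h3

theorem circ_gen (m l : Mono X) :
    circ (toN' (gen m)) (toN' (gen l)) = toN' (gen (m * l)) := by
  rw [circ_toN']
  simp [circL, lam, rhoMono]

theorem circ_assoc (a b c : FmodN' X) : circ (circ a b) c = circ a (circ b c) := by
  have one_circ : ∀ a : FmodN' X, circ 1 a = a := fun a => by rw [circ_comm, circ_one]
  have mul_circ : ∀ a b c : FmodN' X, circ (b * c) a = circ b a * a⁻¹ * circ c a :=
    fun a b c => by rw [circ_comm, circ_mul, circ_comm a b, circ_comm a c]
  have heap_circ : ∀ a b c d : FmodN' X,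
      circ (b * c⁻¹ * d) a = circ b a * (circ c a)⁻¹ * circ d a :=
    fun a b c d => by rw [circ_comm, circ_heap, circ_comm a b, circ_comm a c, circ_comm a d]
  refine affine_ext (g := fun c => circ (circ a b) c) (h := fun c => circ a (circ b c))
    (fun x y => ?_) (fun x y => ?_) ?_ (fun m => ?_) c
  · simp only [circ_mul, circ_one]
  · simp only [circ_mul b, circ_heap, circ_one]
  · simp only [circ_one]
  refine affine_ext (g := fun b => circ (circ a b) (toN' (gen m)))
    (h := fun b => circ a (circ b (toN' (gen m))))
    (fun x y => ?_) (fun x y => ?_) ?_ (fun l => ?_) b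
  · simp only [circ_mul, circ_one, heap_circ]
  · simp only [mul_circ _ x y, circ_heap, one_circ]
  · simp only [circ_one, one_circ]
  refine affine_ext (g := fun a => circ (circ a (toN' (gen l))) (toN' (gen m)))
    (h := fun a => circ a (circ (toN' (gen l)) (toN' (gen m))))
    (fun x y => ?_) (fun x y => ?_) ?_ (fun k => ?_) a
  · simp only [mul_circ _ x y, heap_circ, one_circ]
  · simp only [mul_circ _ x y, one_circ]
  · simp only [one_circ]
  · simp only [circ_gen, mul_assoc]

/-- The commutative wire `F/N'`. -/
noncomputable instance : CommWire (FmodN' X) where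
  circ := circ
  circ_assoc := circ_assoc
  circ_mul := circ_mul
  mul_circ a b c := by rw [circ_comm, circ_mul, circ_comm a b, circ_comm a c]
  circ_comm := circ_comm

/-! ## The commutative wire `𝒲(X)` -/

/-- The group algebra `ℤ[F/N]`. -/
abbrev Coeff (X : Type*) := MonoidAlgebra ℤ (FmodN X)

/-- An element of `F/N` inside `ℤ[F/N]`. -/
noncomputable abbrev emb : FmodN X →* Coeff X := MonoidAlgebra.of ℤ (FmodN X)

/-- Evaluation at `t_x ↦ 1`. -/
noncomputable def evalOne : MvPolynomial X (Coeff X) →+* Coeff X :=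
  MvPolynomial.eval fun _ => 1

/-- Evaluation at `t_x ↦ [x]`. -/
noncomputable def evalX : MvPolynomial X (Coeff X) →+* Coeff X :=
  MvPolynomial.eval fun x => emb (toN (gen (Mono.var x)))

/-- The polynomials `f` over `ℤ[F/N]` with `eval_1 f = 1` and `eval_X f ∈ F/N`. -/
@[ext]
structure PolyWire (X : Type*) where
  poly : MvPolynomial X (Coeff X)
  evalOne_poly : evalOne poly = 1
  evalX_poly : ∃ g : FmodN X, evalX poly = emb g

namespace PolyWire

theorem evalX_C (a : Coeff X) : evalX (MvPolynomial.C a) = a := MvPolynomial.eval_C a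

/-- `f ⋆ g = f + eval_X(f) (g - 1)`. -/
noncomputable def star (f g : PolyWire X) : PolyWire X where
  poly := f.poly + MvPolynomial.C (evalX f.poly) * (g.poly - 1)
  evalOne_poly := by simp [f.evalOne_poly, g.evalOne_poly]
  evalX_poly := by
    obtain ⟨a, ha⟩ := f.evalX_poly
    obtain ⟨b, hb⟩ := g.evalX_poly
    refine ⟨a * b, ?_⟩
    simp only [map_add, map_mul, map_sub, map_one, evalX_C, ha, hb]
    ring

/-- `f ∘ g = f g`. -/
noncomputable def circ (f g : PolyWire X) : PolyWire X where
  poly := f.poly * g.poly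
  evalOne_poly := by simp [f.evalOne_poly, g.evalOne_poly]
  evalX_poly := by
    obtain ⟨a, ha⟩ := f.evalX_poly
    obtain ⟨b, hb⟩ := g.evalX_poly
    exact ⟨a * b, by simp only [map_mul, ha, hb]⟩

/-- The neutral element of `⋆`. -/
noncomputable def one : PolyWire X := ⟨1, map_one _, 1, by rw [map_one, map_one]⟩

/-- The inverse of `eval_X f` in `ℤ[F/N]`. -/
noncomputable def evalXInv (f : PolyWire X) : Coeff X := emb f.evalX_poly.choose⁻¹

theorem evalXInv_mul (f : PolyWire X) : evalXInv f * evalX f.poly = 1 := by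
  have h := f.evalX_poly.choose_spec
  rw [h, evalXInv, ← map_mul, inv_mul_cancel, map_one]

/-- The `⋆`-inverse `1 - eval_X(f)⁻¹ (f - 1)`. -/
noncomputable def inv (f : PolyWire X) : PolyWire X where
  poly := 1 - MvPolynomial.C (evalXInv f) * (f.poly - 1)
  evalOne_poly := by simp [f.evalOne_poly]
  evalX_poly := by
    refine ⟨f.evalX_poly.choose⁻¹, ?_⟩
    simp only [map_sub, map_mul, map_one, evalX_C, mul_sub, evalXInv_mul]
    rw [evalXInv]
    ring

theorem evalX_inv (f : PolyWire X) : evalX (inv f).poly = evalXInv f := by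
  simp only [inv, map_sub, map_mul, map_one, evalX_C, mul_sub, evalXInv_mul]
  ring

noncomputable instance : Group (PolyWire X) :=
  letI : Mul (PolyWire X) := ⟨star⟩
  letI : One (PolyWire X) := ⟨one⟩
  letI : Inv (PolyWire X) := ⟨inv⟩
  Group.ofLeftAxioms
    (fun f g h => PolyWire.ext (by
      change (star (star f g) h).poly = (star f (star g h)).poly
      simp only [star, map_add, map_mul, map_sub, map_one, evalX_C]
      ring))
    (fun f => PolyWire.ext (by
      change (star one f).poly = f.poly
      simp [star, one]))
    (fun f => PolyWire.ext (by
      change (star (inv f) f).poly = 1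
      simp only [star, evalX_inv]
      simp only [inv]
      ring))

theorem mul_poly (f g : PolyWire X) :
    (f * g).poly = f.poly + MvPolynomial.C (evalX f.poly) * (g.poly - 1) := rfl

theorem inv_poly (f : PolyWire X) :
    (f⁻¹).poly = 1 - MvPolynomial.C (evalXInv f) * (f.poly - 1) := rfl

theorem circ_comm (f g : PolyWire X) : circ f g = circ g f :=
  PolyWire.ext (mul_comm f.poly g.poly)

theorem circ_mul (f g h : PolyWire X) : circ f (g * h) = circ f g * f⁻¹ * circ f h := by
  have hf : MvPolynomial.C (σ := X) (evalXInv f) * MvPolynomial.C (evalX f.poly) = 1 := by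
    rw [← map_mul, evalXInv_mul, map_one]
  refine PolyWire.ext ?_
  simp only [circ, mul_poly, inv_poly, map_add, map_mul, map_sub, map_one, evalX_C]
  linear_combination
    (MvPolynomial.C (evalX g.poly) * (f.poly - 1) +
      MvPolynomial.C (evalX g.poly) * (MvPolynomial.C (evalX f.poly) - 1) *
        (f.poly * h.poly - 1)) * hf

/-- The commutative wire `𝒲(X)`. -/
noncomputable instance : CommWire (PolyWire X) where
  circ := circ
  circ_assoc f g h := PolyWire.ext (mul_assoc f.poly g.poly h.poly)
  circ_mul := circ_mul
  mul_circ f g h := by rw [circ_comm, circ_mul, circ_comm f g, circ_comm f h]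
  circ_comm := circ_comm

end PolyWire

/-! ## The polynomial of a word -/

/-- The residue of the Fox derivative `∂u/∂s` in `ℤ[F/N]`. -/
noncomputable def foxDeriv (s : Mono X) (u : F X) : Coeff X :=
  MonoidAlgebra.mapDomainRingHom ℤ toN (Fox.deriv s u)

/-- `f_u = (1 - ∑ₛ ∂u/∂s) + ∑ₛ (∂u/∂s) t_s`, where `t_s` is the monomial with exponent vector `s`.
The sums have finitely many nonzero terms, see `Fox.finite_deriv_ne_zero`. -/
noncomputable def foxPoly (u : F X) : MvPolynomial X (Coeff X) :=
  MvPolynomial.C (1 - ∑ᶠ s : Mono X, foxDeriv s u) +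
    ∑ᶠ s : Mono X, MvPolynomial.C (foxDeriv s u) * MvPolynomial.monomial s.1 1

end FreeCommWire

namespace FreeCommWire

variable {X : Type*}

/-! ## The group `F/N` -/

/-! The relations `[m ∘ l] = [m][l]` make `F/N` the group completion of the free commutative
semigroup on `X`, which is `ℤ^(X)`.

Since `F` is free, `s ↦ t_s` extends to a homomorphism `dHom` into `(𝒲(X), ⋆)`, and `eval_X`
recovers `[u]` from its value at `u` (`evalX_dHom`). Multiplicativity then reads `f_{u⋆v} = f_u +
[u](f_v - 1)`, which is the Fox product rule, so the value is the Fox polynomial (`dHom_poly`). On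
`N` the rule says that `f_n - 1` is additive in `n`, hence `N'` is killed. The distributive laws
reduce compatibility with `∘` to generators, where it is `t_{l∘m} = t_l t_m` (`dHom_circL`).

Bijectivity is a Magnus embedding argument. In the Cayley graph of `F/N` with respect to the
monomials, read `a t_s` as the edge from `a` to `a[s]`, and a constant term as trivial loops. Then
`eval_X - eval_1` is the boundary, `f_u` is up to constants the chain of the path spelled by `u`
from `1`, and `N/N'` is the first homology. Closing each edge by fixed representatives `σ` gives
`loopHom`, which sends `f_u` to the class of `u` when `u ∈ N` (`loopHom_C_mul_dHom`): this is
injectivity. Conversely, a polynomial with both evaluations `1` is recovered from its image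
(`loopPoly_loopHom`): this is surjectivity, after `⋆`-division by some `f_v`. -/

open Classical in
/-- An exponent vector as an element of `F`; the zero vector is sent to the neutral element. -/
noncomputable def genZ (s : X →₀ ℕ) : F X := if h : s = 0 then 1 else gen ⟨s, h⟩

theorem genZ_zero : genZ (0 : X →₀ ℕ) = 1 := dif_pos rfl

theorem genZ_coe (m : Mono X) : genZ m.1 = gen m := dif_neg m.2

theorem toN_genZ_add (s t : X →₀ ℕ) : toN (genZ (s + t)) = toN (genZ s) * toN (genZ t) := by
  by_cases hs : s = 0
  · rw [hs, zero_add, genZ_zero, map_one, one_mul]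
  by_cases ht : t = 0
  · rw [ht, add_zero, genZ_zero, map_one, mul_one]
  obtain ⟨m, rfl⟩ : ∃ m : Mono X, m.1 = s := ⟨⟨s, hs⟩, rfl⟩
  obtain ⟨l, rfl⟩ : ∃ l : Mono X, l.1 = t := ⟨⟨t, ht⟩, rfl⟩
  change toN (genZ (m * l).1) = _
  rw [genZ_coe, genZ_coe, genZ_coe, toN_gen_mul]

/-- The class of an exponent vector in `F/N`, as a homomorphism. -/
noncomputable def expHom : (X →₀ ℕ) →+ Additive (FmodN X) where
  toFun s := Additive.ofMul (toN (genZ s))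
  map_zero' := by rw [genZ_zero, map_one]; rfl
  map_add' s t := by rw [toN_genZ_add]; rfl

/-- The homomorphism `F/N → ℤ^(X)` given by the exponents. -/
noncomputable def toExponent : FmodN X →* Multiplicative (X →₀ ℤ) :=
  QuotientGroup.lift (N X)
    (FreeGroup.lift fun m => Multiplicative.ofAdd
      (Finsupp.mapRange.addMonoidHom (Nat.castAddMonoidHom ℤ) m.1)) (by
    intro n hn
    refine Subgroup.normalClosure_le_normal ?_ hn
    rintro _ ⟨m, l, rfl⟩
    have h : (m * l).1 = m.1 + l.1 := rfl
    rw [SetLike.mem_coe, MonoidHom.mem_ker]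
    simp only [map_mul, map_inv, FreeGroup.lift_apply_of, h, map_add, ofAdd_add]
    group)

theorem toExponent_gen (m : Mono X) : toExponent (toN (gen m)) = Multiplicative.ofAdd
      (Finsupp.mapRange.addMonoidHom (Nat.castAddMonoidHom ℤ) m.1) :=
  FreeGroup.lift_apply_of

/-- The homomorphism `ℤ^(X) → F/N` that sends the basis vector of `x` to `[x]`. -/
noncomputable def ofExponent : Multiplicative (X →₀ ℤ) →* FmodN X :=
  AddMonoidHom.toMultiplicativeLeft (Finsupp.liftAddHom fun x =>
    zmultiplesHom _ (Additive.ofMul (toN (gen (Mono.var x)))))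

theorem ofExponent_single (x : X) :
    ofExponent (Multiplicative.ofAdd (Finsupp.single x 1)) = toN (gen (Mono.var x)) := by
  change Finsupp.liftAddHom (fun x : X =>
    zmultiplesHom _ (Additive.ofMul (toN (gen (Mono.var x))))) (Finsupp.single x 1) =
      Additive.ofMul (toN (gen (Mono.var x)))
  rw [Finsupp.liftAddHom_apply_single, zmultiplesHom_apply, one_smul]

/-- Both sides are additive in `s`, so the basis vectors suffice. This evaluates `ofExponent ∘
toExponent` at every generator `[m]` of `F/N`, not only at the `[x]`. -/
theorem ofExponent_natCast (s : X →₀ ℕ) : ofExponent (Multiplicative.ofAdd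
      (Finsupp.mapRange.addMonoidHom (Nat.castAddMonoidHom ℤ) s)) = toN (genZ s) := by
  have h : (MonoidHom.toAdditiveRight ofExponent).comp
      (Finsupp.mapRange.addMonoidHom (Nat.castAddMonoidHom ℤ)) = expHom (X := X) := by
    ext x
    simp only [AddMonoidHom.comp_apply, Finsupp.singleAddHom_apply,
      Finsupp.mapRange.addMonoidHom_apply, Finsupp.mapRange_single]
    simp only [Nat.coe_castAddMonoidHom, Nat.cast_one]
    change ofExponent (Multiplicative.ofAdd (Finsupp.single x 1)) = toN (genZ (Mono.var x).1)
    rw [ofExponent_single, genZ_coe]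
  exact DFunLike.congr_fun h s

/-- `F/N` is the free commutative group on the classes of the elements of `X`. -/
noncomputable def exponentEquiv : FmodN X ≃* Multiplicative (X →₀ ℤ) :=
  MonoidHom.toMulEquiv toExponent ofExponent
    (by
      refine QuotientGroup.monoidHom_ext _ (FreeGroup.ext_hom _ _ fun m => ?_)
      change ofExponent (toExponent (toN (gen m))) = toN (gen m)
      rw [toExponent_gen, ofExponent_natCast, genZ_coe])
    (by
      refine MonoidHom.toAdditive.injective ?_
      refine Finsupp.addHom_ext' fun x => AddMonoidHom.ext_int ?_
      change toExponent (ofExponent (Multiplicative.ofAdd (Finsupp.single x 1))) =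
        Multiplicative.ofAdd (Finsupp.single x 1)
      rw [ofExponent_single, toExponent_gen]
      simp [Mono.var])

theorem exponentEquiv_var (x : X) : exponentEquiv (toN (gen (Mono.var x))) =
    Multiplicative.ofAdd (Finsupp.single x 1) := by
  change toExponent (toN (gen (Mono.var x))) = _
  rw [toExponent_gen]
  simp [Mono.var]

/-! ## The homomorphism `F → 𝒲(X)` -/

theorem emb_injective : Function.Injective (emb (X := X)) := MonoidAlgebra.of_injective

theorem evalOne_monomial (s : X →₀ ℕ) (a : Coeff X) : evalOne (MvPolynomial.monomial s a) = a := by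
  simp [evalOne, MvPolynomial.eval_monomial]

theorem evalX_monomial (s : X →₀ ℕ) (a : Coeff X) :
    evalX (MvPolynomial.monomial s a) = a * emb (toN (genZ s)) := by
  have key : ∀ s : X →₀ ℕ,
      (s.prod fun x k => emb (toN (gen (Mono.var x))) ^ k) = emb (toN (genZ s)) := by
    intro s
    induction s using Finsupp.induction_linear with
    | zero => rw [Finsupp.prod_zero_index, genZ_zero, map_one, map_one]
    | add s t hs ht =>
      rw [Finsupp.prod_add_index' (fun _ => pow_zero _) (fun _ _ _ => pow_add _ _ _), hs, ht,
        toN_genZ_add, map_mul]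
    | single x k =>
      rw [Finsupp.prod_single_index (by exact pow_zero _), ← map_pow]
      have h1 := map_nsmul (expHom (X := X)) k (Finsupp.single x 1)
      rw [Finsupp.smul_single, smul_eq_mul, mul_one] at h1
      -- This is `h1` read multiplicatively; `Finsupp.single x 1` is the exponent vector of
      -- `Mono.var x`.
      have h2 : toN (genZ (Finsupp.single x k)) = toN (genZ (Mono.var x).1) ^ k := h1
      rw [h2, genZ_coe]
  rw [evalX, MvPolynomial.eval_monomial, key]

/-- The monomial `t_s` as an element of `𝒲(X)`. -/
noncomputable def PolyWire.ofMono (m : Mono X) : PolyWire X where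
  poly := MvPolynomial.monomial m.1 1
  evalOne_poly := evalOne_monomial _ _
  evalX_poly := ⟨toN (gen m), by rw [evalX_monomial, one_mul, genZ_coe]⟩

/-- The homomorphism `F → 𝒲(X)` with `s ↦ t_s`. -/
noncomputable def dHom : F X →* PolyWire X := FreeGroup.lift PolyWire.ofMono

theorem dHom_gen (m : Mono X) : dHom (gen m) = PolyWire.ofMono m := FreeGroup.lift_apply_of

theorem PolyWire.one_poly : (1 : PolyWire X).poly = 1 := rfl

theorem evalX_dHom (u : F X) : evalX (dHom u).poly = emb (toN u) := by
  -- Applying `eval_X` to `f + eval_X(f) (g - 1)` gives `eval_X(f) eval_X(g)`, so `eval_X` turns `⋆`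
  -- into the product of `ℤ[F/N]`.
  let ε : PolyWire X →* Coeff X :=
    { toFun := fun f => evalX f.poly
      map_one' := by rw [PolyWire.one_poly, map_one]
      map_mul' := fun f g => by
        simp only [PolyWire.mul_poly, map_add, map_mul, map_sub, map_one, PolyWire.evalX_C]
        ring }
  have h : ε.comp dHom = emb.comp toN := by
    refine FreeGroup.ext_hom _ _ fun m => ?_
    change evalX (dHom (gen m)).poly = emb (toN (gen m))
    rw [dHom_gen, PolyWire.ofMono, evalX_monomial, one_mul, genZ_coe]
  exact DFunLike.congr_fun h u

theorem dHom_mul_poly (u v : F X) : (dHom (u * v)).poly =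
    (dHom u).poly + MvPolynomial.C (emb (toN u)) * ((dHom v).poly - 1) := by
  rw [map_mul, PolyWire.mul_poly, evalX_dHom]

/-! ## Fox polynomials -/

/-- Concatenating words prefixes every initial section of the second word with the first word. -/
theorem foxDeriv_mul (s : Mono X) (u v : F X) :
    foxDeriv s (u * v) = foxDeriv s u + emb (toN u) * foxDeriv s v := by
  induction u using Quot.inductionOn with | _ L =>
  induction v using Quot.inductionOn with | _ M =>
  have h : Fox.deriv s (FreeGroup.mk L * FreeGroup.mk M) = Fox.deriv s (FreeGroup.mk L) +
      MonoidAlgebra.of ℤ (F X) (FreeGroup.mk L) * Fox.deriv s (FreeGroup.mk M) :=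
    Fox.wordDeriv_append s L M
  change MonoidAlgebra.mapDomainRingHom ℤ toN (Fox.deriv s (FreeGroup.mk L * FreeGroup.mk M)) = _
  rw [h, map_add, map_mul]
  congr 2
  simp only [MonoidAlgebra.of_apply, MonoidAlgebra.mapDomainRingHom_apply,
    MonoidAlgebra.mapDomain_single]
  rfl

theorem foxDeriv_one (s : Mono X) : foxDeriv s 1 = 0 := by
  have h := foxDeriv_mul s 1 1
  rw [mul_one, map_one, map_one, one_mul] at h
  exact left_eq_add.mp h

open Classical in
theorem foxDeriv_gen (s m : Mono X) : foxDeriv s (gen m) = if m = s then 1 else 0 := by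
  have h : Fox.deriv s (gen m) = if m = s then 1 else 0 := by
    change Fox.wordDeriv s [(m, true)] = _
    rw [Fox.wordDeriv_cons]
    simp [Fox.wordDeriv]
  rw [foxDeriv, h]
  split_ifs
  · exact map_one _
  · exact map_zero _

theorem finite_support_foxDeriv (u : F X) :
    (Function.support fun s : Mono X => foxDeriv s u).Finite :=
  (Fox.finite_deriv_ne_zero u).subset fun s hs h => hs (by
    change MonoidAlgebra.mapDomainRingHom ℤ toN (Fox.deriv s u) = 0
    rw [h, map_zero])

/-- In this form `f_u - 1` is linear in the Fox derivatives, so the product rule passes to it term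
by term. -/
theorem foxPoly_eq (u : F X) : foxPoly u =
    1 + ∑ᶠ s : Mono X, MvPolynomial.C (foxDeriv s u) * (MvPolynomial.monomial s.1 1 - 1) := by
  have hf := finite_support_foxDeriv u
  have h1 : (Function.support fun s : Mono X =>
      MvPolynomial.C (foxDeriv s u) * MvPolynomial.monomial s.1 1).Finite :=
    hf.subset fun s hs h => hs (by simp only [h, map_zero, zero_mul])
  have h2 : (Function.support fun s : Mono X =>
      (MvPolynomial.C (foxDeriv s u) : MvPolynomial X (Coeff X))).Finite :=
    hf.subset fun s hs h => hs (by simp only [h, map_zero])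
  simp only [mul_sub, mul_one]
  have h3 : (MvPolynomial.C (∑ᶠ s : Mono X, foxDeriv s u) : MvPolynomial X (Coeff X)) =
      ∑ᶠ s : Mono X, MvPolynomial.C (foxDeriv s u) :=
    AddMonoidHom.map_finsum (MvPolynomial.C (σ := X) (R := Coeff X)).toAddMonoidHom hf
  rw [finsum_sub_distrib h1 h2, foxPoly, map_sub, map_one, h3]
  abel

theorem foxPoly_mul (u v : F X) :
    foxPoly (u * v) = foxPoly u + MvPolynomial.C (emb (toN u)) * (foxPoly v - 1) := by
  have hf : ∀ u : F X, (Function.support fun s : Mono X =>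
      MvPolynomial.C (foxDeriv s u) * (MvPolynomial.monomial s.1 1 - 1)).Finite := fun u =>
    (finite_support_foxDeriv u).subset fun s hs h => hs (by simp only [h, map_zero, zero_mul])
  simp only [foxPoly_eq, foxDeriv_mul, map_add, map_mul, add_mul, add_sub_cancel_left]
  rw [mul_finsum' _ _ (hf v), finsum_add_distrib (hf u), add_assoc]
  · simp only [mul_assoc]
  · refine (hf v).subset fun s hs h => hs ?_
    simp only at h
    simp only [mul_assoc, h, mul_zero]

theorem foxPoly_one : foxPoly (1 : F X) = 1 := by
  simp [foxPoly_eq, foxDeriv_one]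

theorem foxPoly_gen (m : Mono X) : foxPoly (gen m) = MvPolynomial.monomial m.1 1 := by
  classical
  rw [foxPoly_eq, finsum_eq_single _ m]
  · rw [foxDeriv_gen, if_pos rfl, map_one, one_mul]
    ring
  · intro s hs
    rw [foxDeriv_gen, if_neg hs.symm, map_zero, zero_mul]

/-- Both sides obey the same product rule and agree on generators; the rule for `u⁻¹ ⋆ u = 1` forces
the value at inverses. -/
theorem dHom_poly (u : F X) : (dHom u).poly = foxPoly u := by
  induction u using FreeGroup.induction_on with
  | C1 => rw [map_one, foxPoly_one, PolyWire.one_poly]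
  | of m => exact (congrArg PolyWire.poly (dHom_gen m)).trans (foxPoly_gen m).symm
  | inv_of m h =>
    have h1 := dHom_mul_poly (gen m)⁻¹ (gen m)
    have h2 := foxPoly_mul (gen m)⁻¹ (gen m)
    rw [inv_mul_cancel] at h1 h2
    rw [map_one, PolyWire.one_poly, h] at h1
    rw [foxPoly_one] at h2
    exact add_right_cancel (h1.symm.trans h2)
  | mul u v hu hv => rw [dHom_mul_poly, foxPoly_mul, hu, hv]

/-! ## Compatibility with `∘` -/

theorem dHom_gen_mul (l m : Mono X) : dHom (gen (l * m)) = dHom (gen l) ⊚ dHom (gen m) := by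
  have h : (l * m).1 = l.1 + m.1 := rfl
  refine PolyWire.ext ?_
  change (dHom (gen (l * m))).poly = (dHom (gen l)).poly * (dHom (gen m)).poly
  simp only [dHom_gen, PolyWire.ofMono, MvPolynomial.monomial_mul, mul_one, h]

/-- The right distributive law of `𝒲(X)` makes `u ↦ (f_u ∘ f_m) ⋆ f_m⁻¹` a homomorphism, so
comparison with `dHom ∘ ρ_m` on generators is enough. -/
theorem dHom_rhoMono (m : Mono X) (u : F X) :
    dHom (rhoMono m u) * dHom (gen m) = dHom u ⊚ dHom (gen m) := by
  let φ : F X →* PolyWire X := MonoidHom.mk' (fun u => (dHom u ⊚ dHom (gen m)) * (dHom (gen m))⁻¹)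
    (fun a b => by rw [map_mul, Wire.mul_circ]; simp only [mul_assoc])
  have h : dHom.comp (rhoMono m) = φ := by
    refine FreeGroup.ext_hom _ _ fun l => ?_
    change dHom (rhoMono m (gen l)) = (dHom (gen l) ⊚ dHom (gen m)) * (dHom (gen m))⁻¹
    rw [rhoMono, FreeGroup.lift_apply_of, map_mul, map_inv, dHom_gen_mul]
  have h2 : dHom (rhoMono m u) = (dHom u ⊚ dHom (gen m)) * (dHom (gen m))⁻¹ :=
    DFunLike.congr_fun h u
  rw [h2, inv_mul_cancel_right]

/-- By the left distributive law `v ↦ f_u⁻¹ ⋆ (f_u ∘ f_v)` is a homomorphism; on a generator `v = m`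
it agrees with `dHom ∘ λ_u` by `dHom_rhoMono`. -/
theorem dHom_circL (u v : F X) : dHom (circL u v) = dHom u ⊚ dHom v := by
  let φ : F X →* PolyWire X := MonoidHom.mk' (fun v => (dHom u)⁻¹ * (dHom u ⊚ dHom v))
    (fun a b => by rw [map_mul, Wire.circ_mul]; group)
  have h : dHom.comp (lam u) = φ := by
    refine FreeGroup.ext_hom _ _ fun m => ?_
    change dHom (lam u (gen m)) = (dHom u)⁻¹ * (dHom u ⊚ dHom (gen m))
    rw [lam, FreeGroup.lift_apply_of, map_mul, map_inv, map_mul, dHom_rhoMono]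
  have h2 : dHom (lam u v) = (dHom u)⁻¹ * (dHom u ⊚ dHom v) := DFunLike.congr_fun h v
  rw [circL, map_mul, h2, mul_inv_cancel_left]

/-! ## Bijectivity -/

/-- A section of `F → F/N` that preserves the neutral element. -/
theorem exists_section : ∃ σ : FmodN X → F X, (∀ a, toN (σ a) = a) ∧ σ 1 = 1 := by
  classical
  -- `Quotient.out` need not pick the neutral element in the class `1`, so that value is set by
  -- hand.
  refine ⟨fun a => if a = 1 then 1 else Quotient.out a, fun a => ?_, if_pos rfl⟩
  dsimp only
  split_ifs with h
  · rw [h, map_one]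
  · exact Quotient.out_eq a

/-- A section of `F → F/N` that preserves the neutral element. -/
noncomputable def sec : FmodN X → F X := exists_section.choose

theorem toN_sec (a : FmodN X) : toN (sec a) = a := exists_section.choose_spec.1 a

theorem sec_one : sec (1 : FmodN X) = 1 := exists_section.choose_spec.2

/-- The element `σ(a) ⋆ u ⋆ σ(a[u])⁻¹` of `N`. -/
noncomputable def loop (a : FmodN X) (u : F X) : N X :=
  ⟨sec a * u * (sec (a * toN u))⁻¹, (QuotientGroup.eq_one_iff _).mp (by
    change toN (sec a * u * (sec (a * toN u))⁻¹) = 1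
    rw [map_mul, map_mul, map_inv, toN_sec, toN_sec, mul_inv_cancel])⟩

/-- The two factors `σ(a[u])⁻¹` and `σ(a[u])` in the middle cancel. -/
theorem loop_mul (a : FmodN X) (u v : F X) :
    loop a (u * v) = loop a u * loop (a * toN u) v := by
  refine Subtype.ext ?_
  simp only [loop, Subgroup.coe_mul, map_mul, mul_assoc, inv_mul_cancel_left]

theorem loop_one (a : FmodN X) : loop a 1 = 1 := by
  refine Subtype.ext ?_
  simp only [loop, map_one, mul_one, mul_inv_cancel, Subgroup.coe_one]

/-- The additive map `ℤ[F/N][t] → N/N'` that sends `a t_s` to the class of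
`σ(a) ⋆ s ⋆ σ(a[s])⁻¹`. -/
noncomputable def loopHom : MvPolynomial X (Coeff X) →+ Additive (Abelianization (N X)) :=
  (Finsupp.liftAddHom fun s : X →₀ ℕ =>
    (Finsupp.liftAddHom fun a : FmodN X =>
      zmultiplesHom _ (Additive.ofMul (Abelianization.of (loop a (genZ s))))).comp
        (MonoidAlgebra.coeffAddEquiv (R := ℤ) (M := FmodN X)).toAddMonoidHom).comp
    (AddMonoidAlgebra.coeffAddEquiv (R := Coeff X) (M := X →₀ ℕ)).toAddMonoidHom

theorem loopHom_monomial (s : X →₀ ℕ) (a : FmodN X) :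
    loopHom (MvPolynomial.monomial s (emb a)) =
      Additive.ofMul (Abelianization.of (loop a (genZ s))) := by
  change Finsupp.liftAddHom _ (Finsupp.single s (emb a)) = _
  rw [Finsupp.liftAddHom_apply_single]
  change Finsupp.liftAddHom _ (Finsupp.single a (1 : ℤ)) = _
  rw [Finsupp.liftAddHom_apply_single, zmultiplesHom_apply, one_smul]

theorem coeff_addHom_ext {G : Type*} [AddCommGroup G] {φ ψ : Coeff X →+ G}
    (h : ∀ a, φ (emb a) = ψ (emb a)) : φ = ψ := by
  refine MonoidAlgebra.addMonoidHom_ext fun a k => ?_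
  have hk : MonoidAlgebra.single a k = k • emb a := by
    rw [MonoidAlgebra.of_apply, MonoidAlgebra.smul_single, smul_eq_mul, mul_one]
  rw [hk, map_zsmul, map_zsmul, h]

theorem polynomial_addHom_ext {G : Type*} [AddCommGroup G]
    {φ ψ : MvPolynomial X (Coeff X) →+ G}
    (h : ∀ s a, φ (MvPolynomial.monomial s (emb a)) = ψ (MvPolynomial.monomial s (emb a))) :
    φ = ψ := by
  refine AddMonoidHom.ext fun p => ?_
  induction p using MvPolynomial.induction_on' with
  | add p q hp hq => rw [map_add, map_add, hp, hq]
  | monomial s a =>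
    exact DFunLike.congr_fun (coeff_addHom_ext
      (φ := φ.comp (MvPolynomial.monomial s).toAddMonoidHom)
      (ψ := ψ.comp (MvPolynomial.monomial s).toAddMonoidHom) (h s)) a

/-- A constant belongs to the exponent vector `0`, which `genZ` sends to `1`, so its loops are
trivial. -/
theorem loopHom_C (a : Coeff X) : loopHom (MvPolynomial.C a) = 0 := by
  have h : (loopHom (X := X)).comp MvPolynomial.C.toAddMonoidHom = 0 :=
    coeff_addHom_ext fun a => by
      change loopHom (MvPolynomial.monomial 0 (emb a)) = 0
      rw [loopHom_monomial, genZ_zero, loop_one, map_one, ofMul_one]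
  exact DFunLike.congr_fun h a

/-- Modulo constants, which `loopHom` kills, the product rule for `f` matches `loop_mul`. The base
point `a` stays quantified in the induction because the second factor starts at `a[u]`. -/
theorem loopHom_C_mul_dHom (u : F X) : ∀ a : FmodN X,
    loopHom (MvPolynomial.C (emb a) * (dHom u).poly) =
      Additive.ofMul (Abelianization.of (loop a u)) := by
  have hmul : ∀ (u v : F X) (a : FmodN X),
      loopHom (MvPolynomial.C (emb a) * (dHom (u * v)).poly) =
        loopHom (MvPolynomial.C (emb a) * (dHom u).poly) +
          loopHom (MvPolynomial.C (emb (a * toN u)) * (dHom v).poly) := fun u v a => by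
    rw [dHom_mul_poly, mul_add, map_add, ← mul_assoc, ← map_mul, ← map_mul, mul_sub, mul_one,
      map_sub, loopHom_C, sub_zero]
  have hone : ∀ a : FmodN X, loopHom (MvPolynomial.C (emb a) * (dHom 1).poly) = 0 := fun a => by
    rw [map_one, PolyWire.one_poly, mul_one, loopHom_C]
  induction u using FreeGroup.induction_on with
  | C1 => exact fun a => by rw [hone, loop_one, map_one, ofMul_one]
  | of m =>
    intro a
    change loopHom (MvPolynomial.C (emb a) * (dHom (gen m)).poly) =
      Additive.ofMul (Abelianization.of (loop a (gen m)))
    rw [dHom_gen, PolyWire.ofMono, MvPolynomial.C_mul_monomial, mul_one, loopHom_monomial,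
      genZ_coe]
  | inv_of m h =>
    intro a
    -- Both sides are split along `m⁻¹ ⋆ m = 1`; the hypothesis for `m`, used at the base point
    -- `a[m]⁻¹`, then cancels.
    have h1 := hmul (gen m)⁻¹ (gen m) a
    have h2 := loop_mul a (gen m)⁻¹ (gen m)
    rw [inv_mul_cancel, hone] at h1
    rw [inv_mul_cancel, loop_one] at h2
    have h3 : (0 : Additive (Abelianization (N X))) =
        Additive.ofMul (Abelianization.of (loop a (gen m)⁻¹)) +
          Additive.ofMul (Abelianization.of (loop (a * toN (gen m)⁻¹) (gen m))) := by
      rw [← ofMul_mul, ← map_mul, ← h2, map_one, ofMul_one]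
    rw [h, h3] at h1
    exact (add_right_cancel h1).symm
  | mul u v hu hv =>
    intro a
    rw [hmul, hu, hv, loop_mul, map_mul, ofMul_mul]

theorem mem_commutator_of_abelianization_eq_one {n : N X} (h : Abelianization.of n = 1) :
    (n : F X) ∈ ⁅N X, N X⁆ := by
  have h1 : n ∈ commutator (N X) := by
    rw [← Abelianization.ker_of]
    exact h
  rw [← Subgroup.map_subtype_commutator]
  exact Subgroup.mem_map_of_mem (N X).subtype h1

/-- For `u, v ∈ N` the coefficients `[u]` and `[v]` are `1`, so the product rule gives `f_u + f_v -
1` in either order. -/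
theorem commutator_le_ker_dHom : ⁅N X, N X⁆ ≤ (dHom (X := X)).ker := by
  rw [Subgroup.commutator_le]
  intro u hu v hv
  have hone : ∀ u ∈ N X, toN u = 1 := fun u hu => (QuotientGroup.eq_one_iff u).mpr hu
  rw [MonoidHom.mem_ker, map_commutatorElement, commutatorElement_eq_one_iff_mul_comm,
    ← map_mul, ← map_mul]
  refine PolyWire.ext ?_
  rw [dHom_mul_poly, dHom_mul_poly, hone u hu, hone v hv, map_one, map_one]
  ring

/-- The map `𝔡 : F/N' → 𝒲(X)`, `[u] ↦ f_u`. -/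
noncomputable def dMap : FmodN' X →* PolyWire X :=
  QuotientGroup.lift _ dHom commutator_le_ker_dHom

theorem dMap_toN' (u : F X) : dMap (toN' u) = dHom u := rfl

/-- If `f_u = 1`, then `[u] = eval_X(f_u) = 1`, and `σ(1) = 1` makes the loop of `u` at `1` equal to
`u`. Its class in `N/N'` is `loopHom 1 = 0`. -/
theorem dMap_injective : Function.Injective (dMap (X := X)) := by
  rw [injective_iff_map_eq_one]
  intro a ha
  induction a using QuotientGroup.induction_on with | H u =>
  have h1 : (dHom u).poly = 1 := congrArg PolyWire.poly ha
  have h2 : toN u = 1 := emb_injective (by rw [← evalX_dHom, h1, map_one, map_one])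
  have h3 := loopHom_C_mul_dHom u 1
  rw [h1, mul_one, loopHom_C] at h3
  have h4 := mem_commutator_of_abelianization_eq_one (n := loop 1 u) h3.symm
  have h5 : (loop 1 u : F X) = u := by
    simp only [loop, h2, one_mul, mul_one, sec_one, inv_one]
  rw [h5] at h4
  exact (QuotientGroup.eq_one_iff u).mpr h4

/-- The additive map `N/N' → ℤ[F/N][t]`, `[n] ↦ f_n - 1`. -/
noncomputable def loopPoly : Additive (Abelianization (N X)) →+ MvPolynomial X (Coeff X) :=
  MonoidHom.toAdditiveLeft (Abelianization.lift
    { toFun := fun n => Multiplicative.ofAdd ((dHom (n : F X)).poly - 1)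
      map_one' := by
        rw [Subgroup.coe_one, map_one, PolyWire.one_poly, sub_self, ofAdd_zero]
      map_mul' := fun n k => by
        -- With `[n] = 1` the product rule becomes additivity of `f - 1`.
        have h : toN (n : F X) = 1 := (QuotientGroup.eq_one_iff _).mpr n.2
        rw [Subgroup.coe_mul, dHom_mul_poly, h, map_one, map_one, one_mul, ← ofAdd_add]
        congr 1
        ring })

theorem loopPoly_of (n : N X) :
    loopPoly (Additive.ofMul (Abelianization.of n)) = (dHom (n : F X)).poly - 1 := rfl

/-- The additive map `ℤ[F/N] → ℤ[F/N][t]` that sends `a` to `f_{σ(a)} - 1`. -/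
noncomputable def secPoly : Coeff X →+ MvPolynomial X (Coeff X) :=
  (Finsupp.liftAddHom fun a : FmodN X => zmultiplesHom _ ((dHom (sec a)).poly - 1)).comp
    (MonoidAlgebra.coeffAddEquiv (R := ℤ) (M := FmodN X)).toAddMonoidHom

theorem secPoly_emb (a : FmodN X) : secPoly (emb a) = (dHom (sec a)).poly - 1 := by
  change Finsupp.liftAddHom _ (Finsupp.single a (1 : ℤ)) = _
  rw [Finsupp.liftAddHom_apply_single, zmultiplesHom_apply, one_smul]

/-- The product rule is applied to both sides of `loop ⋆ σ(a[u]) = σ(a) ⋆ u`, where the loop has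
class `1`. -/
theorem loop_dHom_poly (a : FmodN X) (u : F X) :
    (dHom (loop a u : F X)).poly - 1 = MvPolynomial.C (emb a) * ((dHom u).poly - 1) +
      ((dHom (sec a)).poly - (dHom (sec (a * toN u))).poly) := by
  have h : (loop a u : F X) * sec (a * toN u) = sec a * u := inv_mul_cancel_right _ _
  have h1 : toN (loop a u : F X) = 1 := (QuotientGroup.eq_one_iff _).mpr (loop a u).2
  have h2 := congrArg (fun w => (dHom w).poly) h
  simp only [dHom_mul_poly, h1, map_one, one_mul, toN_sec] at h2
  linear_combination h2

/-- By additivity it suffices to take an edge `p = a t_s`, which is `loop_dHom_poly`. The endpoints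
`a` and `a[s]` are its values under `eval_1` and `eval_X`, so the correction through `σ` depends
only on the boundary and vanishes on cycles. -/
theorem loopPoly_loopHom (p : MvPolynomial X (Coeff X)) : loopPoly (loopHom p) =
    p - MvPolynomial.C (evalOne p) + (secPoly (evalOne p) - secPoly (evalX p)) := by
  let ψ : MvPolynomial X (Coeff X) →+ MvPolynomial X (Coeff X) :=
    AddMonoidHom.id _ - MvPolynomial.C.toAddMonoidHom.comp evalOne.toAddMonoidHom +
      (secPoly.comp evalOne.toAddMonoidHom - secPoly.comp evalX.toAddMonoidHom)
  have h : loopPoly.comp loopHom = ψ := polynomial_addHom_ext fun s a => by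
    change loopPoly (loopHom (MvPolynomial.monomial s (emb a))) =
      MvPolynomial.monomial s (emb a) - MvPolynomial.C (evalOne (MvPolynomial.monomial s (emb a))) +
        (secPoly (evalOne (MvPolynomial.monomial s (emb a))) -
          secPoly (evalX (MvPolynomial.monomial s (emb a))))
    have hs : (dHom (genZ s)).poly = MvPolynomial.monomial s 1 := by
      by_cases h0 : s = 0
      · rw [h0, genZ_zero, map_one]
        rfl
      · obtain ⟨m, rfl⟩ : ∃ m : Mono X, m.1 = s := ⟨⟨s, h0⟩, rfl⟩
        rw [genZ_coe, dHom_gen]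
        rfl
    rw [loopHom_monomial, loopPoly_of, loop_dHom_poly, hs, evalOne_monomial, evalX_monomial,
      ← map_mul, secPoly_emb, secPoly_emb, mul_sub, MvPolynomial.C_mul_monomial, mul_one, mul_one]
    ring
  exact DFunLike.congr_fun h p

theorem dMap_surjective : Function.Surjective (dMap (X := X)) := by
  have key : ∀ f : PolyWire X, evalX f.poly = 1 → ∃ u : F X, dHom u = f := by
    intro f hf
    obtain ⟨n, hn⟩ : ∃ n : N X, Abelianization.of n = Additive.toMul (loopHom f.poly) :=
      QuotientGroup.mk_surjective _
    have h1 := loopPoly_loopHom f.poly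
    have h2 := loopPoly_of n
    -- Both evaluations of `f` are `1`, so the `secPoly` terms cancel and `f - 1 = f_n - 1` remains.
    rw [hn, ofMul_toMul, h1, f.evalOne_poly, hf, sub_self, add_zero, map_one] at h2
    exact ⟨n, PolyWire.ext (sub_left_injective h2).symm⟩
  intro f
  obtain ⟨g, hg⟩ := f.evalX_poly
  obtain ⟨v, rfl⟩ := QuotientGroup.mk'_surjective (N X) g
  -- Since `[v] = eval_X(f)`, dividing by `f_v` on the right brings `eval_X` to `1`.
  obtain ⟨u, hu⟩ := key (f * dHom v⁻¹) (by
    rw [PolyWire.mul_poly]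
    simp only [map_add, map_mul, map_sub, map_one, PolyWire.evalX_C, evalX_dHom, hg]
    rw [mul_sub, ← map_mul, map_inv, mul_inv_cancel, map_one]
    ring)
  refine ⟨toN' (u * v), ?_⟩
  rw [dMap_toN', map_mul, hu, map_inv, inv_mul_cancel_right]

end FreeCommWire

open FreeCommWire in
theorem mainTheorem2 (X : Type*) :
    (∃ φ : FmodN X ≃* Multiplicative (X →₀ ℤ),
      ∀ x : X, φ (toN (gen (Mono.var x))) = Multiplicative.ofAdd (Finsupp.single x 1)) ∧
    ∃ 𝔡 : FmodN' X → PolyWire X,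
      (∀ u : F X, (𝔡 (toN' u)).poly = foxPoly u) ∧ IsWireIso 𝔡 := by
  refine ⟨⟨exponentEquiv, exponentEquiv_var⟩, dMap, fun u => dHom_poly u, ⟨⟨map_mul dMap, ?_⟩,
    dMap_injective, dMap_surjective⟩⟩
  intro a b
  induction a using QuotientGroup.induction_on with | H u =>
  induction b using QuotientGroup.induction_on with | H v =>
  exact dHom_circL u v
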